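/- Let $d\ge 0$ be an integer, let $\mathcal H_d=\mathbb C^d$ with its standard orthonormal basis, and identify the operators $L(\mathcal H_d)$ with the complex $d\times d$ matrices. For a matrix $X$ let $\|X\|_1=\operatorname{Tr}\sqrt{X^\dagger X}$. For a linear map $\Phi$ on a space $L(\mathcal H)$ let $\|\Phi\|_1=\sup_{\|X\|_1\le 1}\|\Phi(X)\|_1$, and let $\|\Phi\|_\diamond=\sup_{n\ge 1}\|\Phi\otimes I_{L(\mathbb C^n)}\|_1$ be the diamond norm. For a linear map $\Phi$ on $L(\mathcal H_d)$ and a set $C$ of such maps, put $$D(\Phi,C)=\inf\{\|\Phi-\Psi\|_\diamond:\Psi\in C\}.$$ A Schur channel on $L(\mathcal H_d)$ is a map of the form $X\mapsto S\circ X$ (entrywise product) with $S$ positive semidefinite and $s_{kk}=1$ for all $k$; let $\mathrm S_d$ be the set of Schur channels. Let $\mathrm{Conv}(\mathbb U_d)$ be the convex hull of the unitary channels $X\mapsto UXU^\dagger$ ($U$ a unitary $d\times d$ matrix), and let $\Lambda_d=\mathrm S_d\cap\mathrm{Conv}(\mathbb U_d)$ (equivalently, $\Lambda_d$ is the set of mixtures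 of channels $X\mapsto UXU^\dagger$ with $U$ a diagonal unitary matrix). Then for every Schur channel $\Phi\in\mathrm S_d$ these distances are finite and $$\tfrac12\,D(\Phi,\Lambda_d)\;\le\; D(\Phi,\mathrm{Conv}(\mathbb U_d))\;\le\; D(\Phi,\Lambda_d).$$ -/

import Mathlib

namespace QuantumBirkhoff

open Matrix
open scoped ENNReal ComplexOrder MatrixOrder Matrix.Norms.L2Operator Kronecker

/-- The space of super-operators `T(H)`, i.e. linear maps on the operators `L(H)`, where operators
on the Hilbert space with distinguished orthonormal basis indexed by `m` are written as matrices. -/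
abbrev SuperOp (m : Type*) : Type _ := Matrix m m ℂ →ₗ[ℂ] Matrix m m ℂ

/-- The trace norm `‖X‖₁ = Tr |X|` with `|X| = √(X† X)`. -/
noncomputable def traceNorm {m : Type*} [Fintype m] [DecidableEq m] (X : Matrix m m ℂ) : ℝ :=
  (CFC.abs X).trace.re

/-- The induced trace norm `‖Φ‖₁ = sup {‖Φ(X)‖₁ : ‖X‖₁ ≤ 1}` of a super-operator, as a supremum in
`[0, ∞]`. -/
noncomputable def superTraceNorm {m : Type*} [Fintype m] [DecidableEq m] (Φ : SuperOp m) : ℝ≥0∞ :=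
  ⨆ (X : Matrix m m ℂ) (_ : traceNorm X ≤ 1), ENNReal.ofReal (traceNorm (Φ X))

/-- The super-operator `Φ ⊗ I` on `L(H ⊗ K)`: `Φ` acts on the first tensor factor. -/
def tensorId {m : Type*} (Φ : SuperOp m) (n : Type*) : SuperOp (m × n) where
  toFun X := Matrix.of fun p q => Φ (Matrix.of fun i j => X (i, p.2) (j, q.2)) p.1 q.1
  map_add' X Y := by
    ext p q
    exact congrFun (congrFun (Φ.map_add (Matrix.of fun i j => X (i, p.2) (j, q.2))
      (Matrix.of fun i j => Y (i, p.2) (j, q.2))) p.1) q.1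
  map_smul' c X := by
    ext p q
    exact congrFun (congrFun (Φ.map_smul c (Matrix.of fun i j => X (i, p.2) (j, q.2))) p.1) q.1

/-- `Φ ⊗ I` is the map determined by `A ⊗ B ↦ Φ(A) ⊗ B`. -/
theorem tensorId_kronecker {m n : Type*} (Φ : SuperOp m) (A : Matrix m m ℂ) (B : Matrix n n ℂ) :
    tensorId Φ n (A ⊗ₖ B) = Φ A ⊗ₖ B := by
  ext p q
  have h : (Matrix.of fun i j => (A ⊗ₖ B) (i, p.2) (j, q.2)) = B p.2 q.2 • A := by
    ext i j
    simp [Matrix.kroneckerMap_apply, mul_comm]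
  change Φ (Matrix.of fun i j => (A ⊗ₖ B) (i, p.2) (j, q.2)) p.1 q.1 = _
  rw [h, map_smul]
  simp [Matrix.kroneckerMap_apply, mul_comm]

/-- The diamond norm (completely bounded trace norm) `sup_{n ≥ 1} ‖Φ ⊗ I_{L(H_n)}‖₁`, as a
supremum in `[0, ∞]`. -/
noncomputable def diamondNorm {m : Type*} [Fintype m] [DecidableEq m] (Φ : SuperOp m) : ℝ≥0∞ :=
  ⨆ (n : ℕ) (_ : 1 ≤ n), superTraceNorm (tensorId Φ (Fin n))

/-- The trace distance `D(Φ, C) = inf {‖Φ - Ψ‖_⋄ : Ψ ∈ C}` from a super-operator to a set of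
super-operators, as an infimum in `[0, ∞]`. -/
noncomputable def channelDist {m : Type*} [Fintype m] [DecidableEq m] (Φ : SuperOp m)
    (C : Set (SuperOp m)) : ℝ≥0∞ :=
  ⨅ Ψ ∈ C, diamondNorm (Φ - Ψ)

/-- The Schur multiplier `X ↦ S ∘ X` (entrywise product). -/
def schurMultiplier {m : Type*} (S : Matrix m m ℂ) : SuperOp m where
  toFun X := S ⊙ X
  map_add' X Y := Matrix.hadamard_add S X Y
  map_smul' c X := Matrix.hadamard_smul S X c

/-- The set `S_d` of Schur channels: Schur multipliers by positive semidefinite matrices with unit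
diagonal. -/
def schurChannels (d : ℕ) : Set (SuperOp (Fin d)) :=
  {Φ | ∃ S : Matrix (Fin d) (Fin d) ℂ, S.PosSemidef ∧ (∀ k, S k k = 1) ∧ Φ = schurMultiplier S}

/-- The map `X ↦ U X U†`. -/
def conjBy {m : Type*} [Fintype m] (U : Matrix m m ℂ) : SuperOp m where
  toFun X := U * X * Uᴴ
  map_add' X Y := by rw [Matrix.mul_add, Matrix.add_mul]
  map_smul' c X := by simp

/-- The set of unitary channels `X ↦ U X U†`, `U` unitary, on `L(H_d)`. -/
def unitaryChannels (d : ℕ) : Set (SuperOp (Fin d)) :=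
  {Φ | ∃ U ∈ Matrix.unitaryGroup (Fin d) ℂ, Φ = conjBy U}

/-- The convex hull of the unitary channels, i.e. the mixtures of unitary channels. -/
def convUnitary (d : ℕ) : Set (SuperOp (Fin d)) :=
  convexHull ℝ (unitaryChannels d)

/-- The set `Λ_d` of Schur channels which are mixtures of unitary channels. -/
def schurMixedUnitary (d : ℕ) : Set (SuperOp (Fin d)) :=
  schurChannels d ∩ convUnitary d

/-- The set of diagonal unitary channels. -/
def diagonalUnitaryChannels (d : ℕ) : Set (SuperOp (Fin d)) :=
  {Φ | ∃ U ∈ Matrix.unitaryGroup (Fin d) ℂ, U.IsDiag ∧ Φ = conjBy U}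

theorem convex_schurChannels (d : ℕ) : Convex ℝ (schurChannels d) := by
  rintro _ ⟨S, hS, hS1, rfl⟩ _ ⟨T, hT, hT1, rfl⟩ a b ha hb hab
  refine ⟨a • S + b • T, (hS.smul ha).add (hT.smul hb), fun k => ?_, ?_⟩
  · simp only [Matrix.add_apply, Matrix.smul_apply, hS1, hT1, Complex.real_smul, mul_one]
    exact_mod_cast hab
  · ext X i j
    simp [schurMultiplier]
    ring

/-- `Λ_d` is exactly the set of mixtures of diagonal unitary channels. -/
theorem schurMixedUnitary_eq (d : ℕ) :
    schurMixedUnitary d = convexHull ℝ (diagonalUnitaryChannels d) := by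
  apply Set.Subset.antisymm
  · rintro Φ ⟨⟨S, -, -, rfl⟩, hΦ⟩
    obtain ⟨ι, _, w, z, hw, hw1, hz, hsum⟩ := mem_convexHull_iff_exists_fintype.1 hΦ
    choose U hU hzU using hz
    have key : ∀ k, w k ≠ 0 → (U k).IsDiag := by
      intro k hk i j hij
      have h := congrArg (fun Ψ : SuperOp (Fin d) => (Ψ (Matrix.single j j 1) i i).re) hsum
      have h2 : ∀ k, (z k (Matrix.single j j 1) i i).re = Complex.normSq (U k i j) := by
        intro k
        simp [hzU, conjBy, Matrix.mul_apply, Matrix.single_apply, Complex.normSq_apply,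
          Finset.sum_ite_eq, ite_and]
      have h3 : ∑ k, w k * Complex.normSq (U k i j) = 0 := by
        simpa [h2, LinearMap.sum_apply, Matrix.sum_apply, schurMultiplier, Matrix.single_apply,
          hij.symm] using h
      have h4 := (Finset.sum_eq_zero_iff_of_nonneg
        (fun k _ => mul_nonneg (hw k) (Complex.normSq_nonneg _))).1 h3 k (Finset.mem_univ k)
      simpa [hk] using h4
    rw [← hsum, ← Finset.sum_filter_of_ne (p := fun k => w k ≠ 0)
      (fun k _ hk h0 => hk (by simp [h0]))]
    refine (convex_convexHull ℝ _).sum_mem (fun k _ => hw k) ?_ fun k hk => ?_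
    · rw [Finset.sum_filter_ne_zero, hw1]
    · exact subset_convexHull ℝ _ ⟨U k, hU k, key k (Finset.mem_filter.1 hk).2, hzU k⟩
  · refine convexHull_min ?_ ((convex_schurChannels d).inter (convex_convexHull ℝ _))
    rintro _ ⟨U, hU, hUd, rfl⟩
    refine ⟨⟨Matrix.vecMulVec U.diag (star U.diag), Matrix.posSemidef_vecMulVec_self_star _,
      fun k => ?_, ?_⟩, subset_convexHull ℝ _ ⟨U, hU, rfl⟩⟩
    · have h := congrFun (congrFun (Matrix.mem_unitaryGroup_iff.1 hU) k) k
      rw [← hUd.diagonal_diag, Matrix.star_eq_conjTranspose, Matrix.diagonal_conjTranspose,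
        Matrix.diagonal_mul_diagonal] at h
      simpa [Matrix.vecMulVec_apply] using h
    · ext X i j
      change (U * X * Uᴴ) i j = _
      rw [← hUd.diagonal_diag, Matrix.diagonal_conjTranspose]
      simp [schurMultiplier, Matrix.vecMulVec_apply, Matrix.mul_diagonal]
      ring

end QuantumBirkhoff

namespace QuantumBirkhoff

open Matrix
open scoped ENNReal ComplexOrder MatrixOrder Matrix.Norms.L2Operator Kronecker ComplexConjugate

/-! ### The trace norm by duality with the operator norm. -/

section TraceNorm

variable {m : Type*} [Fintype m] [DecidableEq m]

/-! The upper bound is just the inclusion of `Λ_d` in the mixtures of unitary channels. For the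
lower bound, a mixture `Ψ` is replaced by `schurCompletion Ψ`, the multiplier with unit diagonal and
off-diagonal entries `Ψ(E_ij)_ij`, which costs at most a factor 2.

It lies in `Λ_d` (`schurCompletion_mem`): the construction is affine in `Ψ`, and a unitary `U` gives
the off-diagonal entries `u_i conj(u_j)` with `u` the diagonal of `U`, so `|u_i| ≤ 1`. The
dependence on each `u_i` separately is affine, and the disc is the convex hull of the circle, so it
suffices to treat unimodular `u`, where the multiplier is conjugation by a diagonal unitary.

The factor 2 is `diamondNorm_offDiagPart_le`: averaging over diagonal unitaries is a contraction, as
is discarding the off-diagonal part of the input. The off-diagonal multiplier of `Φ - Ψ` is the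
average minus its restriction to diagonal inputs, a difference of two maps of norm at most `‖Φ -
Ψ‖_⋄`. -/

theorem re_trace_mul_posSemidef_le (A P : Matrix m m ℂ) (hP : P.PosSemidef) :
    (A * P).trace.re ≤ ‖A‖ * P.trace.re := by
  set V : Matrix m m ℂ := (hP.1.eigenvectorUnitary : Matrix m m ℂ) with hV
  have hVu : V ∈ Matrix.unitaryGroup m ℂ := hP.1.eigenvectorUnitary.2
  have hs : P = V * diagonal (fun i => (hP.1.eigenvalues i : ℂ)) * star V := by
    have := hP.1.spectral_theorem
    rw [Unitary.conjStarAlgAut_apply] at this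
    exact this
  have key : ∀ B : Matrix m m ℂ, (B * P).trace.re =
      ∑ i, ((star V * B * V) i i).re * hP.1.eigenvalues i := by
    intro B
    have h1 : (B * P).trace = (star V * B * V * diagonal
        (fun i => (hP.1.eigenvalues i : ℂ))).trace := by
      conv_lhs => rw [hs, ← mul_assoc, trace_mul_comm]
      simp only [mul_assoc]
    rw [h1, trace]
    simp [Matrix.mul_diagonal]
  have hone : star V * 1 * V = 1 := by
    rw [mul_one]; exact (Matrix.mem_unitaryGroup_iff'.1 hVu)
  have h1 := key 1
  rw [hone, one_mul] at h1
  rw [key, h1, Finset.mul_sum]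
  refine Finset.sum_le_sum fun i _ => ?_
  simp only [Matrix.one_apply_eq, Complex.one_re, one_mul]
  refine mul_le_mul_of_nonneg_right ?_ (hP.eigenvalues_nonneg i)
  calc ((star V * A * V) i i).re ≤ ‖(star V * A * V) i i‖ := Complex.re_le_norm _
    _ ≤ ‖star V * A * V‖ := by
        have h := Matrix.l2_opNorm_mulVec (star V * A * V) (EuclideanSpace.single i 1)
        have h2 := PiLp.norm_apply_le (WithLp.toLp 2 ((star V * A * V) *ᵥ (EuclideanSpace.single i (1:ℂ)).ofLp)) i
        refine le_trans (by simp) (h2.trans (h.trans (by simp)))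
    _ = ‖A‖ := by
        rw [CStarRing.norm_mul_mem_unitary _ hVu,
          CStarRing.norm_mem_unitary_mul _ (Unitary.star_mem hVu)]

theorem exists_polar (X : Matrix m m ℂ) :
    ∃ W : Matrix m m ℂ, ‖W‖ ≤ 1 ∧ W * X = CFC.abs X ∧ star W * CFC.abs X = X := by
  set P := CFC.abs X with hPdef
  have hP : 0 ≤ P := CFC.abs_nonneg X
  have hPsa : IsSelfAdjoint P := IsSelfAdjoint.of_nonneg hP
  have hsq : P * P = star X * X := CFC.abs_mul_abs X
  have hc : ∀ f : ℝ → ℝ, ContinuousOn f (spectrum ℝ P) := fun f =>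
    (Matrix.finite_real_spectrum (A := P)).continuousOn f
  -- Since `0⁻¹ = 0`, `Q` is the pseudo-inverse of `|X|` and `E = QP` below is its support
  -- projection. The function is discontinuous at 0, which is harmless on a finite spectrum.
  set Q := cfc (fun x : ℝ => x⁻¹) P with hQ
  have hQsa : star Q = Q := cfc_predicate (fun x : ℝ => x⁻¹) P
  have hPid : P = cfc (fun x : ℝ => x) P := (cfc_id' ℝ P).symm
  have hQPP : Q * (P * P) = P := by
    conv_lhs => rw [hPid]
    rw [hQ, ← cfc_mul _ _ _ (hc _) (hc _), ← cfc_mul _ _ _ (hc _) (hc _)]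
    conv_rhs => rw [hPid]
    congr 1
    ext x
    by_cases h : x = 0
    · simp [h]
    · field_simp
  set E := cfc (fun x : ℝ => x⁻¹ * x) P with hE
  have hQP : Q * P = E := by
    conv_lhs => rw [hPid]
    rw [hQ, ← cfc_mul _ _ _ (hc _) (hc _)]
  have hEsa : star E = E := cfc_predicate (fun x : ℝ => x⁻¹ * x) P
  have hPQ : P * Q = E := by
    rw [← hEsa, ← hQP, star_mul, hQsa, hPsa.star_eq]
  have hPE : P * E = P := by
    conv_rhs => rw [← hPsa.star_eq, ← hQPP, star_mul, star_mul, hQsa, hPsa.star_eq]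
    rw [← hPQ, mul_assoc]
  have hEnorm : ‖E‖ ≤ 1 := by
    refine norm_cfc_le zero_le_one fun x _ => ?_
    by_cases h : x = 0
    · simp [h]
    · simp [h]
  have hEE : E * E = E := by
    rw [hE, ← cfc_mul _ _ _ (hc _) (hc _)]
    congr 1
    ext x
    by_cases h : x = 0
    · simp [h]
    · simp [h]
  have hXE : X * E = X := by
    rw [← sub_eq_zero, ← CStarRing.star_mul_self_eq_zero_iff]
    rw [star_sub, star_mul, hEsa, sub_mul, mul_sub, mul_sub]
    have h1 : star X * (X * E) = star X * X := by
      rw [← mul_assoc, ← hsq, mul_assoc, hPE]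
    rw [mul_assoc, mul_assoc, h1]
    simp
  refine ⟨Q * star X, ?_, ?_, ?_⟩
  · have : ‖Q * star X‖ * ‖Q * star X‖ ≤ 1 := by
      rw [← CStarRing.norm_self_mul_star, star_mul, star_star, hQsa]
      have : Q * star X * (X * Q) = E := by
        rw [mul_assoc, ← mul_assoc (star X), ← hsq, mul_assoc P, hPQ, hPE, hQP]
      rw [this]
      exact hEnorm
    nlinarith [norm_nonneg (Q * star X)]
  · rw [mul_assoc, ← hsq, hQPP]
  · rw [star_mul, star_star, hQsa, mul_assoc, hQP, hXE]

theorem traceNorm_nonneg (X : Matrix m m ℂ) : 0 ≤ traceNorm X :=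
  (Complex.le_def.1 (Matrix.nonneg_iff_posSemidef.1 (CFC.abs_nonneg X)).trace_nonneg).1

theorem re_trace_mul_le (A X : Matrix m m ℂ) : (A * X).trace.re ≤ ‖A‖ * traceNorm X := by
  obtain ⟨W, hW, -, h⟩ := exists_polar X
  have hpos : (CFC.abs X).PosSemidef := Matrix.nonneg_iff_posSemidef.1 (CFC.abs_nonneg X)
  calc (A * X).trace.re = (A * star W * CFC.abs X).trace.re := by rw [mul_assoc, h]
    _ ≤ ‖A * star W‖ * traceNorm X := re_trace_mul_posSemidef_le _ _ hpos
    _ ≤ ‖A‖ * traceNorm X := by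
      refine mul_le_mul_of_nonneg_right ?_ (traceNorm_nonneg X)
      calc ‖A * star W‖ ≤ ‖A‖ * ‖star W‖ := norm_mul_le _ _
        _ ≤ ‖A‖ * 1 := by rw [norm_star]; gcongr
        _ = ‖A‖ := mul_one _

/-- The polar contraction attains the supremum. This dual form yields the triangle inequality and
the contraction estimates without manipulating square roots. -/
theorem traceNorm_le_iff {X : Matrix m m ℂ} {c : ℝ} :
    traceNorm X ≤ c ↔ ∀ W : Matrix m m ℂ, ‖W‖ ≤ 1 → (W * X).trace.re ≤ c := by
  constructor
  · intro h W hW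
    exact (re_trace_mul_le W X).trans ((mul_le_of_le_one_left (traceNorm_nonneg X) hW).trans h)
  · intro h
    obtain ⟨W, hW, hWX, -⟩ := exists_polar X
    have := h W hW
    rwa [hWX] at this

theorem traceNorm_add_le (X Y : Matrix m m ℂ) :
    traceNorm (X + Y) ≤ traceNorm X + traceNorm Y := by
  refine traceNorm_le_iff.2 fun W hW => ?_
  rw [mul_add, trace_add, Complex.add_re]
  exact add_le_add (traceNorm_le_iff.1 le_rfl W hW) (traceNorm_le_iff.1 le_rfl W hW)

theorem traceNorm_smul_le (c : ℂ) (X : Matrix m m ℂ) :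
    traceNorm (c • X) ≤ ‖c‖ * traceNorm X := by
  refine traceNorm_le_iff.2 fun W hW => ?_
  rw [mul_smul_comm, ← smul_mul_assoc]
  refine (re_trace_mul_le _ X).trans (mul_le_mul_of_nonneg_right ?_ (traceNorm_nonneg X))
  rw [norm_smul]
  exact mul_le_of_le_one_right (norm_nonneg c) hW

theorem traceNorm_mul_mul_le {A B : Matrix m m ℂ} (hA : ‖A‖ ≤ 1) (hB : ‖B‖ ≤ 1)
    (X : Matrix m m ℂ) : traceNorm (A * X * B) ≤ traceNorm X := by
  refine traceNorm_le_iff.2 fun W hW => ?_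
  rw [← mul_assoc, trace_mul_comm, ← mul_assoc, ← mul_assoc]
  refine traceNorm_le_iff.1 le_rfl _ ?_
  calc ‖B * W * A‖ ≤ ‖B‖ * ‖W‖ * ‖A‖ := (norm_mul_le _ _).trans (by gcongr; exact norm_mul_le _ _)
    _ ≤ 1 * 1 * 1 := by gcongr
    _ = 1 := by norm_num

end TraceNorm


/-! ### Diamond norm estimates for sums, averages and Schur multipliers. -/

section DiamondNorm

variable {m : Type*} [Fintype m] [DecidableEq m]

theorem diamondNorm_le_iff {Φ : SuperOp m} {c : ℝ≥0∞} :
    diamondNorm Φ ≤ c ↔ ∀ n : ℕ, 1 ≤ n → ∀ X : Matrix (m × Fin n) (m × Fin n) ℂ,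
      traceNorm X ≤ 1 → ENNReal.ofReal (traceNorm (tensorId Φ (Fin n) X)) ≤ c := by
  simp only [diamondNorm, superTraceNorm, iSup_le_iff]

theorem ofReal_traceNorm_tensorId_le (Φ : SuperOp m) {n : ℕ} (hn : 1 ≤ n)
    {X : Matrix (m × Fin n) (m × Fin n) ℂ} (hX : traceNorm X ≤ 1) :
    ENNReal.ofReal (traceNorm (tensorId Φ (Fin n) X)) ≤ diamondNorm Φ :=
  diamondNorm_le_iff.1 le_rfl n hn X hX

theorem diamondNorm_add_le (Φ Ψ : SuperOp m) :
    diamondNorm (Φ + Ψ) ≤ diamondNorm Φ + diamondNorm Ψ := by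
  refine diamondNorm_le_iff.2 fun n hn X hX => ?_
  have h : tensorId (Φ + Ψ) (Fin n) X = tensorId Φ (Fin n) X + tensorId Ψ (Fin n) X := rfl
  rw [h]
  refine (ENNReal.ofReal_le_ofReal (traceNorm_add_le _ _)).trans ?_
  rw [ENNReal.ofReal_add (traceNorm_nonneg _) (traceNorm_nonneg _)]
  exact add_le_add (ofReal_traceNorm_tensorId_le Φ hn hX) (ofReal_traceNorm_tensorId_le Ψ hn hX)

theorem diamondNorm_smul_le (c : ℂ) (Φ : SuperOp m) :
    diamondNorm (c • Φ) ≤ ENNReal.ofReal ‖c‖ * diamondNorm Φ := by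
  refine diamondNorm_le_iff.2 fun n hn X hX => ?_
  have h : tensorId (c • Φ) (Fin n) X = c • tensorId Φ (Fin n) X := rfl
  rw [h]
  refine (ENNReal.ofReal_le_ofReal (traceNorm_smul_le _ _)).trans ?_
  rw [ENNReal.ofReal_mul (norm_nonneg c)]
  gcongr
  exact ofReal_traceNorm_tensorId_le Φ hn hX

theorem diamondNorm_zero : diamondNorm (0 : SuperOp m) = 0 := by
  have h := diamondNorm_smul_le 0 (0 : SuperOp m)
  simpa using h

theorem diamondNorm_sub_le (Φ Ψ : SuperOp m) :
    diamondNorm (Φ - Ψ) ≤ diamondNorm Φ + diamondNorm Ψ := by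
  have h : Φ - Ψ = Φ + (-1 : ℂ) • Ψ := by module
  rw [h]
  refine (diamondNorm_add_le _ _).trans (add_le_add le_rfl ?_)
  simpa using diamondNorm_smul_le (-1) Ψ

theorem diamondNorm_sum_le {ι : Type*} (s : Finset ι) (Φ : ι → SuperOp m) :
    diamondNorm (∑ i ∈ s, Φ i) ≤ ∑ i ∈ s, diamondNorm (Φ i) := by
  classical
  induction s using Finset.induction_on with
  | empty => simp [diamondNorm_zero]
  | insert i s hi ih =>
    rw [Finset.sum_insert hi, Finset.sum_insert hi]
    exact (diamondNorm_add_le _ _).trans (add_le_add le_rfl ih)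

theorem diamondNorm_average_le {ι : Type*} [Fintype ι] [Nonempty ι] {Φ : ι → SuperOp m}
    {c : ℝ≥0∞} (h : ∀ i, diamondNorm (Φ i) ≤ c) :
    diamondNorm ((Fintype.card ι : ℂ)⁻¹ • ∑ i, Φ i) ≤ c := by
  refine (diamondNorm_smul_le _ _).trans ?_
  have h1 : diamondNorm (∑ i, Φ i) ≤ Fintype.card ι * c :=
    (diamondNorm_sum_le _ _).trans ((Finset.sum_le_sum fun i _ => h i).trans (by simp))
  refine (mul_le_mul_right h1 _).trans ?_
  have h0 : (0 : ℝ) < Fintype.card ι := by exact_mod_cast Fintype.card_pos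
  rw [norm_inv, Complex.norm_natCast, ENNReal.ofReal_inv_of_pos h0, ENNReal.ofReal_natCast,
    ← mul_assoc, ENNReal.inv_mul_cancel (by simp) (by simp), one_mul]

/-- A rank-one multiplier acts as left and right multiplication by diagonal contractions, also after
tensoring with the identity. -/
theorem traceNorm_tensorId_schurMultiplier_le {a b : m → ℂ} (ha : ∀ i, ‖a i‖ ≤ 1)
    (hb : ∀ i, ‖b i‖ ≤ 1) (n : ℕ) (X : Matrix (m × Fin n) (m × Fin n) ℂ) :
    traceNorm (tensorId (schurMultiplier (vecMulVec a b)) (Fin n) X) ≤ traceNorm X := by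
  have h : tensorId (schurMultiplier (vecMulVec a b)) (Fin n) X =
      diagonal (fun p : m × Fin n => a p.1) * X * diagonal (fun p : m × Fin n => b p.1) := by
    ext p q
    simp [tensorId, schurMultiplier, vecMulVec_apply]
    ring
  rw [h]
  refine traceNorm_mul_mul_le ?_ ?_ X
  · rw [l2_opNorm_diagonal]
    exact (pi_norm_le_iff_of_nonneg zero_le_one).2 fun p => ha p.1
  · rw [l2_opNorm_diagonal]
    exact (pi_norm_le_iff_of_nonneg zero_le_one).2 fun p => hb p.1

theorem tensorId_comp_apply {m n : Type*} (Φ Ψ : SuperOp m) (X : Matrix (m × n) (m × n) ℂ) :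
    tensorId (Φ ∘ₗ Ψ) n X = tensorId Φ n (tensorId Ψ n X) := rfl

theorem diamondNorm_comp_schurMultiplier_le (Φ : SuperOp m) {a b : m → ℂ} (ha : ∀ i, ‖a i‖ ≤ 1)
    (hb : ∀ i, ‖b i‖ ≤ 1) :
    diamondNorm (Φ ∘ₗ schurMultiplier (vecMulVec a b)) ≤ diamondNorm Φ := by
  refine diamondNorm_le_iff.2 fun n hn X hX => ?_
  rw [tensorId_comp_apply]
  exact ofReal_traceNorm_tensorId_le Φ hn
    ((traceNorm_tensorId_schurMultiplier_le ha hb n X).trans hX)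

theorem diamondNorm_schurMultiplier_comp_le (Φ : SuperOp m) {a b : m → ℂ} (ha : ∀ i, ‖a i‖ ≤ 1)
    (hb : ∀ i, ‖b i‖ ≤ 1) :
    diamondNorm (schurMultiplier (vecMulVec a b) ∘ₗ Φ) ≤ diamondNorm Φ := by
  refine diamondNorm_le_iff.2 fun n hn X hX => ?_
  rw [tensorId_comp_apply]
  exact (ENNReal.ofReal_le_ofReal
    (traceNorm_tensorId_schurMultiplier_le ha hb n (tensorId Φ (Fin n) X))).trans
    (ofReal_traceNorm_tensorId_le Φ hn hX)

theorem diamondNorm_schurMultiplier_lt_top (S : Matrix m m ℂ) :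
    diamondNorm (schurMultiplier S) < ⊤ := by
  -- Splitting into matrix units leaves finitely many rank-one multipliers, each of finite norm.
  have h : schurMultiplier S = ∑ i, ∑ j, S i j •
      (schurMultiplier (vecMulVec (Pi.single i 1) (Pi.single j 1)) ∘ₗ LinearMap.id) := by
    refine LinearMap.ext fun X => ?_
    ext k l
    simp [schurMultiplier, LinearMap.sum_apply, Matrix.sum_apply, vecMulVec_apply, Pi.single_apply]
  have hid : diamondNorm (LinearMap.id : SuperOp m) ≤ 1 := by
    refine diamondNorm_le_iff.2 fun n hn X hX => ?_
    rw [← ENNReal.ofReal_one]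
    exact ENNReal.ofReal_le_ofReal hX
  have hs : ∀ i j : m, ‖(Pi.single i 1 : m → ℂ) j‖ ≤ 1 := by
    intro i j
    by_cases hij : j = i <;> simp [hij]
  rw [h]
  refine (diamondNorm_sum_le _ _).trans_lt (ENNReal.sum_lt_top.2 fun i _ => ?_)
  refine (diamondNorm_sum_le _ _).trans_lt (ENNReal.sum_lt_top.2 fun j _ => ?_)
  refine (diamondNorm_smul_le _ _).trans_lt (ENNReal.mul_lt_top ENNReal.ofReal_lt_top ?_)
  exact ((diamondNorm_schurMultiplier_comp_le _ (hs i) (hs j)).trans hid).trans_lt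
    ENNReal.one_lt_top

end DiamondNorm

/-! ### Averaging over diagonal unitaries of order three. -/

section Twirl

variable {d : ℕ}

/-- The diagonal vectors with entries cube roots of unity, indexed by exponents. -/
noncomputable def phase (f : Fin d → ZMod 3) (i : Fin d) : ℂ := ZMod.stdAddChar (f i)

theorem norm_phase (f : Fin d → ZMod 3) (i : Fin d) : ‖phase f i‖ = 1 :=
  AddChar.norm_apply _ _

theorem phase_add (f g : Fin d → ZMod 3) (i : Fin d) :
    phase (f + g) i = phase f i * phase g i := AddChar.map_add_eq_mul _ _ _

theorem conj_phase_mul_self (f : Fin d → ZMod 3) (i : Fin d) :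
    conj (phase f i) * phase f i = 1 := by
  rw [Complex.conj_mul', norm_phase]; simp

theorem sum_eq_zero_of_translate {G : Type*} [Fintype G] [AddGroup G] {F : G → ℂ} {g : G} {c : ℂ}
    (hc : c ≠ 1) (h : ∀ f, F (f + g) = c * F f) : ∑ f, F f = 0 := by
  have h1 : ∑ f, F f = c * ∑ f, F f := by
    rw [Finset.mul_sum, ← Equiv.sum_comp (Equiv.addRight g) F]
    exact Finset.sum_congr rfl fun f _ => h f
  have h2 : (1 - c) * ∑ f, F f = 0 := by rw [sub_mul, one_mul, ← h1, sub_self]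
  exact (mul_eq_zero.1 h2).resolve_left (sub_ne_zero.2 hc.symm)

theorem stdAddChar_ne_one {x : ZMod 3} (hx : x ≠ 0) : (ZMod.stdAddChar x : ℂ) ≠ 1 := by
  rw [← (ZMod.stdAddChar (N := 3)).map_zero_eq_one]
  exact fun h => hx (ZMod.injective_stdAddChar h)

theorem sum_phase_two {i j : Fin d} (hij : i ≠ j) :
    ∑ f : Fin d → ZMod 3, phase f i * conj (phase f j) = 0 := by
  refine sum_eq_zero_of_translate (g := Pi.single i 1)
    (stdAddChar_ne_one (x := 1) (by decide)) fun f => ?_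
  simp only [phase_add, map_mul]
  simp [phase, hij.symm]
  ring

/-- The summand is a character with exponent `-e_i + e_l + e_j - e_k`, and it sums to zero unless
this exponent vanishes. Signs would not suffice: modulo 2 the case `i = k`, `l = j` survives as
well. -/
theorem sum_phase_four {i j k l : Fin d} (hjk : j ≠ k) (h : ¬(i = j ∧ l = k)) :
    ∑ f : Fin d → ZMod 3,
      conj (phase f i) * phase f l * (phase f j * conj (phase f k)) = 0 := by
  have key : ∀ g f : Fin d → ZMod 3,
      conj (phase (f + g) i) * phase (f + g) l * (phase (f + g) j * conj (phase (f + g) k)) =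
      ZMod.stdAddChar (-g i + g l + (g j - g k)) *
        (conj (phase f i) * phase f l * (phase f j * conj (phase f k))) := by
    intro g f
    simp only [phase_add, map_mul, sub_eq_add_neg, AddChar.map_add_eq_mul, AddChar.map_neg_eq_conj]
    simp only [phase]
    ring
  by_cases hij : i = j
  · subst hij
    have hlk : l ≠ k := fun hh => h ⟨rfl, hh⟩
    refine sum_eq_zero_of_translate (stdAddChar_ne_one ?_) (key (Pi.single k 1))
    simp [hjk, hlk]
  · refine sum_eq_zero_of_translate (stdAddChar_ne_one ?_) (key (Pi.single j 1))
    -- The exponent at `j` is 2 or 1, nonzero modulo 3 either way.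
    by_cases hlj : l = j
    · simp only [Pi.single_apply, hij, hlj, hjk.symm, if_true, if_false]
      decide
    · simp only [Pi.single_apply, hij, hlj, hjk.symm, if_true, if_false]
      decide

/-- The average of `D† Ξ(D X D†) D` over the diagonal unitaries `D` of order three. -/
noncomputable def twirl (Ξ : SuperOp (Fin d)) : SuperOp (Fin d) :=
  (Fintype.card (Fin d → ZMod 3) : ℂ)⁻¹ • ∑ f : Fin d → ZMod 3,
    schurMultiplier (vecMulVec (star (phase f)) (phase f)) ∘ₗ
      (Ξ ∘ₗ schurMultiplier (vecMulVec (phase f) (star (phase f))))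

/-- The multiplier with entries `Ξ(E_ij)_ij` off the diagonal, and `0` on it. -/
def offDiagPart (Ξ : SuperOp (Fin d)) : SuperOp (Fin d) :=
  schurMultiplier (Matrix.of fun i j => if i = j then 0 else Ξ (single i j 1) i j)

theorem diamondNorm_twirl_le (Ξ : SuperOp (Fin d)) : diamondNorm (twirl Ξ) ≤ diamondNorm Ξ := by
  refine diamondNorm_average_le fun f => ?_
  have h1 : ∀ i, ‖phase f i‖ ≤ 1 := fun i => (norm_phase f i).le
  have h2 : ∀ i, ‖star (phase f) i‖ ≤ 1 := fun i => by
    rw [Pi.star_apply, norm_star]; exact h1 i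
  exact (diamondNorm_schurMultiplier_comp_le _ h2 h1).trans
    (diamondNorm_comp_schurMultiplier_le _ h1 h2)

theorem schurMultiplier_one_eq_average :
    (schurMultiplier 1 : SuperOp (Fin d)) = (Fintype.card (Fin d → ZMod 3) : ℂ)⁻¹ •
      ∑ f : Fin d → ZMod 3, schurMultiplier (vecMulVec (phase f) (star (phase f))) := by
  refine LinearMap.ext fun X => ?_
  ext i j
  have h0 : (Fintype.card (Fin d → ZMod 3) : ℂ) ≠ 0 := by
    exact_mod_cast Fintype.card_ne_zero
  simp only [schurMultiplier, LinearMap.smul_apply, LinearMap.sum_apply, LinearMap.coe_mk,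
    AddHom.coe_mk, Matrix.smul_apply, Matrix.sum_apply, hadamard_apply, vecMulVec_apply,
    Pi.star_apply, RCLike.star_def, ← Finset.sum_mul, smul_eq_mul]
  by_cases hij : i = j
  · subst hij
    rw [Finset.sum_congr rfl fun f _ => (mul_comm _ _).trans (conj_phase_mul_self f i)]
    rw [Finset.sum_const, Finset.card_univ, nsmul_eq_mul, mul_one, ← mul_assoc,
      inv_mul_cancel₀ h0, Matrix.one_apply_eq]
  · simp [sum_phase_two hij, hij]

theorem diamondNorm_comp_pinch_le (Ξ : SuperOp (Fin d)) :
    diamondNorm (Ξ ∘ₗ schurMultiplier 1) ≤ diamondNorm Ξ := by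
  have h : Ξ ∘ₗ schurMultiplier 1 = (Fintype.card (Fin d → ZMod 3) : ℂ)⁻¹ •
      ∑ f : Fin d → ZMod 3, Ξ ∘ₗ schurMultiplier (vecMulVec (phase f) (star (phase f))) := by
    refine LinearMap.ext fun X => ?_
    simp [schurMultiplier_one_eq_average, LinearMap.sum_apply]
  rw [h]
  refine diamondNorm_average_le fun f => ?_
  have h1 : ∀ i, ‖phase f i‖ ≤ 1 := fun i => (norm_phase f i).le
  have h2 : ∀ i, ‖star (phase f) i‖ ≤ 1 := fun i => by
    rw [Pi.star_apply, norm_star]; exact h1 i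
  exact diamondNorm_comp_schurMultiplier_le _ h1 h2

theorem schurMultiplier_single {m : Type*} [DecidableEq m] (S : Matrix m m ℂ) (j k : m) (c : ℂ) :
    schurMultiplier S (single j k c) = S j k • single j k c := by
  ext i l
  simp only [schurMultiplier, LinearMap.coe_mk, AddHom.coe_mk, hadamard_apply, Matrix.smul_apply,
    single_apply, smul_eq_mul]
  by_cases h : j = i ∧ k = l
  · obtain ⟨rfl, rfl⟩ := h; simp
  · simp [h]

/-- For `j ≠ k` the average keeps only the `(j, k)` entry of `Ξ(E_jk)`. On `E_jj` it can leave other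
diagonal entries, and the subtracted term removes all of these. -/
theorem offDiagPart_eq (Ξ : SuperOp (Fin d)) :
    offDiagPart Ξ = twirl Ξ - twirl Ξ ∘ₗ schurMultiplier 1 := by
  have h0 : (Fintype.card (Fin d → ZMod 3) : ℂ) ≠ 0 := by
    exact_mod_cast Fintype.card_ne_zero
  refine Matrix.ext_linearMap _ fun j k => LinearMap.ext_ring ?_
  simp only [LinearMap.comp_apply, LinearMap.sub_apply, singleLinearMap_apply, offDiagPart,
    schurMultiplier_single, map_smul]
  by_cases hjk : j = k
  · subst hjk; simp
  simp only [of_apply, if_neg hjk, one_apply_ne hjk, zero_smul, sub_zero]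
  ext i l
  simp only [twirl, LinearMap.smul_apply, LinearMap.sum_apply, LinearMap.comp_apply,
    schurMultiplier_single, map_smul, Matrix.smul_apply, Matrix.sum_apply, smul_eq_mul]
  have h1 : ∀ f : Fin d → ZMod 3, vecMulVec (phase f) (star (phase f)) j k *
      (schurMultiplier (vecMulVec (star (phase f)) (phase f)) (Ξ (single j k 1))) i l =
      conj (phase f i) * phase f l * (phase f j * conj (phase f k)) * Ξ (single j k 1) i l := by
    intro f
    simp [schurMultiplier, vecMulVec_apply]
    ring
  simp only [h1, ← Finset.sum_mul]
  by_cases h : i = j ∧ l = k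
  · obtain ⟨rfl, rfl⟩ := h
    have h2 : ∀ f : Fin d → ZMod 3,
        conj (phase f i) * phase f l * (phase f i * conj (phase f l)) = 1 := by
      intro f
      rw [mul_mul_mul_comm, conj_phase_mul_self, mul_comm (phase f l), conj_phase_mul_self, one_mul]
    simp [h2]
  · rw [sum_phase_four hjk h, zero_mul, mul_zero, single_apply, if_neg, mul_zero]
    rintro ⟨rfl, rfl⟩
    exact h ⟨rfl, rfl⟩

theorem diamondNorm_offDiagPart_le (Ξ : SuperOp (Fin d)) :
    diamondNorm (offDiagPart Ξ) ≤ 2 * diamondNorm Ξ := by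
  rw [offDiagPart_eq, two_mul]
  exact (diamondNorm_sub_le _ _).trans (add_le_add (diamondNorm_twirl_le Ξ)
    ((diamondNorm_comp_pinch_le _).trans (diamondNorm_twirl_le Ξ)))

end Twirl

/-! ### Replacing a mixture of unitary channels by a Schur channel in `Λ_d`. -/

section SchurCompletion

variable {d : ℕ}

/-- The multiplier with unit diagonal and entries `Ψ(E_ij)_ij` off the diagonal. -/
def schurCompletion (Ψ : SuperOp (Fin d)) : SuperOp (Fin d) :=
  schurMultiplier (Matrix.of fun i j => if i = j then 1 else Ψ (single i j 1) i j)

theorem sub_schurCompletion {Φ : SuperOp (Fin d)} (hΦ : Φ ∈ schurChannels d)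
    (Ψ : SuperOp (Fin d)) : Φ - schurCompletion Ψ = offDiagPart (Φ - Ψ) := by
  obtain ⟨S, -, hS, rfl⟩ := hΦ
  refine LinearMap.ext fun X => ?_
  ext i j
  by_cases h : i = j
  · subst h
    simp [schurMultiplier, schurCompletion, offDiagPart, hS]
  · simp [schurMultiplier, schurCompletion, offDiagPart, h, sub_mul]

theorem schurCompletion_combo (Ψ₁ Ψ₂ : SuperOp (Fin d)) {a b : ℝ} (hab : a + b = 1) :
    schurCompletion (a • Ψ₁ + b • Ψ₂) = a • schurCompletion Ψ₁ + b • schurCompletion Ψ₂ := by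
  have hab' : (a : ℂ) + b = 1 := by exact_mod_cast hab
  refine LinearMap.ext fun X => ?_
  ext i j
  by_cases h : i = j
  · subst h
    simp [schurMultiplier, schurCompletion, ← add_mul, hab']
  · simp [schurMultiplier, schurCompletion, h]
    ring

/-- The multiplier with unit diagonal and off-diagonal entries those of `u u†`. -/
noncomputable def unitDiagMultiplier (u : Fin d → ℂ) : SuperOp (Fin d) :=
  schurMultiplier (Matrix.of fun i j => if i = j then 1 else u i * conj (u j))

theorem schurCompletion_conjBy (U : Matrix (Fin d) (Fin d) ℂ) :
    schurCompletion (conjBy U) = unitDiagMultiplier U.diag := by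
  unfold schurCompletion unitDiagMultiplier
  congr 2
  ext i j
  simp [conjBy, Matrix.mul_apply, single_apply, ite_and]

/-- With the diagonal frozen at 1 instead of `|u_i|²`, every entry contains at most one of `u_i` and
`conj(u_i)`, to first order. Real weights commute with conjugation. -/
theorem unitDiagMultiplier_update_combo (u : Fin d → ℂ) (i : Fin d) (x y : ℂ) {a b : ℝ}
    (hab : a + b = 1) :
    unitDiagMultiplier (Function.update u i (a • x + b • y)) =
      a • unitDiagMultiplier (Function.update u i x) +
        b • unitDiagMultiplier (Function.update u i y) := by
  have hab' : (b : ℂ) = 1 - a := by rw [eq_sub_iff_add_eq']; exact_mod_cast hab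
  refine LinearMap.ext fun X => ?_
  ext k l
  by_cases h : k = l
  · subst h
    simp [schurMultiplier, unitDiagMultiplier, hab']
    ring
  · by_cases hk : k = i
    · subst hk
      simp [schurMultiplier, unitDiagMultiplier, h, Function.update_of_ne (Ne.symm h)]
      ring
    · by_cases hl : l = i
      · subst hl
        simp [schurMultiplier, unitDiagMultiplier, h]
        ring
      · simp [schurMultiplier, unitDiagMultiplier, h, hk, hl, hab']
        ring

theorem unitDiagMultiplier_mem_of_norm_eq_one {u : Fin d → ℂ} (hu : ∀ i, ‖u i‖ = 1) :
    unitDiagMultiplier u ∈ schurMixedUnitary d := by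
  rw [schurMixedUnitary_eq]
  have h1 : ∀ i, u i * conj (u i) = 1 := fun i => by rw [Complex.mul_conj', hu]; simp
  refine subset_convexHull ℝ _ ⟨diagonal u, ?_, isDiag_diagonal u, ?_⟩
  · rw [Matrix.mem_unitaryGroup_iff, star_eq_conjTranspose, diagonal_conjTranspose,
      diagonal_mul_diagonal]
    simp [h1]
  · refine LinearMap.ext fun X => ?_
    ext i j
    by_cases h : i = j
    · subst h
      simp [schurMultiplier, unitDiagMultiplier, conjBy, diagonal_conjTranspose,
        mul_right_comm _ (X i i), h1]
    · simp [schurMultiplier, unitDiagMultiplier, conjBy, diagonal_conjTranspose, mul_right_comm, h]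

theorem convex_schurMixedUnitary (d : ℕ) : Convex ℝ (schurMixedUnitary d) :=
  (convex_schurChannels d).inter (convex_convexHull ℝ _)

theorem unitDiagMultiplier_mem {u : Fin d → ℂ} (hu : ∀ i, ‖u i‖ ≤ 1) :
    unitDiagMultiplier u ∈ schurMixedUnitary d := by
  -- Here `s` collects the coordinates allowed inside the disc; the induction moves them to the
  -- circle one at a time.
  have key : ∀ (s : Finset (Fin d)) (u : Fin d → ℂ), (∀ i, ‖u i‖ ≤ 1) →
      (∀ i ∉ s, ‖u i‖ = 1) → unitDiagMultiplier u ∈ schurMixedUnitary d := by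
    intro s
    induction s using Finset.induction_on with
    | empty => exact fun u _ h => unitDiagMultiplier_mem_of_norm_eq_one fun i => h i (by simp)
    | insert i s _ ih =>
      intro u hu h
      have hconv : Convex ℝ
          {z : ℂ | unitDiagMultiplier (Function.update u i z) ∈ schurMixedUnitary d} := by
        intro x hx y hy a b ha hb hab
        rw [Set.mem_ofPred_eq, unitDiagMultiplier_update_combo u i x y hab]
        exact convex_schurMixedUnitary d hx hy ha hb hab
      have hsph : Metric.sphere (0 : ℂ) 1 ⊆
          {z : ℂ | unitDiagMultiplier (Function.update u i z) ∈ schurMixedUnitary d} := by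
        intro z hz
        have hz' : ‖z‖ = 1 := by simpa using hz
        refine ih _ (fun j => ?_) fun j hj => ?_
        · by_cases hji : j = i
          · subst hji; simp [hz']
          · simpa [hji] using hu j
        · by_cases hji : j = i
          · subst hji; simp [hz']
          · simpa [hji] using h j (by simp [hji, hj])
      have hball := convexHull_min hsph hconv
      rw [convexHull_sphere_eq_closedBall _ zero_le_one] at hball
      have := hball (show u i ∈ Metric.closedBall (0 : ℂ) 1 by simpa using hu i)
      simpa using this
  exact key Finset.univ u hu (by simp)

theorem schurCompletion_mem {Ψ : SuperOp (Fin d)} (hΨ : Ψ ∈ convUnitary d) :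
    schurCompletion Ψ ∈ schurMixedUnitary d := by
  have hconv : Convex ℝ {Ψ : SuperOp (Fin d) | schurCompletion Ψ ∈ schurMixedUnitary d} := by
    intro x hx y hy a b ha hb hab
    rw [Set.mem_ofPred_eq, schurCompletion_combo x y hab]
    exact convex_schurMixedUnitary d hx hy ha hb hab
  refine convexHull_min ?_ hconv hΨ
  rintro _ ⟨U, hU, rfl⟩
  rw [Set.mem_ofPred_eq, schurCompletion_conjBy]
  exact unitDiagMultiplier_mem fun i => entry_norm_bound_of_unitary hU i i

end SchurCompletion

end QuantumBirkhoff

theorem theorem3 (d : ℕ) (Φ : QuantumBirkhoff.SuperOp (Fin d))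
    (hΦ : Φ ∈ QuantumBirkhoff.schurChannels d) :
    (1 / 2 : ENNReal) * QuantumBirkhoff.channelDist Φ (QuantumBirkhoff.schurMixedUnitary d)
        ≤ QuantumBirkhoff.channelDist Φ (QuantumBirkhoff.convUnitary d) ∧
      QuantumBirkhoff.channelDist Φ (QuantumBirkhoff.convUnitary d)
        ≤ QuantumBirkhoff.channelDist Φ (QuantumBirkhoff.schurMixedUnitary d) ∧
      QuantumBirkhoff.channelDist Φ (QuantumBirkhoff.schurMixedUnitary d) < ⊤ := by
  refine ⟨?_, biInf_mono fun Ψ hΨ => hΨ.2, ?_⟩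
  · refine le_iInf₂ fun Ψ hΨ => ?_
    have h : QuantumBirkhoff.channelDist Φ (QuantumBirkhoff.schurMixedUnitary d) ≤
        2 * QuantumBirkhoff.diamondNorm (Φ - Ψ) := by
      refine (iInf₂_le _ (QuantumBirkhoff.schurCompletion_mem hΨ)).trans ?_
      rw [QuantumBirkhoff.sub_schurCompletion hΦ]
      exact QuantumBirkhoff.diamondNorm_offDiagPart_le _
    calc _ ≤ (1 / 2 : ENNReal) * (2 * QuantumBirkhoff.diamondNorm (Φ - Ψ)) := by gcongr
      _ = QuantumBirkhoff.diamondNorm (Φ - Ψ) := by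
        rw [← mul_assoc, one_div, ENNReal.inv_mul_cancel two_ne_zero ENNReal.ofNat_ne_top, one_mul]
  · obtain ⟨S, -, -, rfl⟩ := hΦ
    -- Any member of `Λ_d` bounds the infimum; `u = 1` gives the identity channel.
    refine (iInf₂_le _ (QuantumBirkhoff.unitDiagMultiplier_mem (u := 1) (by simp))).trans_lt ?_
    refine (QuantumBirkhoff.diamondNorm_sub_le _ _).trans_lt (ENNReal.add_lt_top.2 ⟨?_, ?_⟩)
    · exact QuantumBirkhoff.diamondNorm_schurMultiplier_lt_top S
    · exact QuantumBirkhoff.diamondNorm_schurMultiplier_lt_top _
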